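/- Let $\Omega$ be a finite set (of pixels), $X=\mathbb{R}^\Omega$ with the Euclidean norm, $A:X\to Y$ a bounded linear operator into a real inner product space, $u_0\in Y$, $\nabla=[\nabla_1,\nabla_2]^T$ with linear operators $\nabla_1,\nabla_2:X\to\mathbb{R}^\Omega$ (the components of a discrete gradient), and $\lambda,\mu>0$. Put $f(u)=\tfrac12\|Au-u_0\|^2$ and $|\nabla u|_p^2=\sum_{l=1}^2(\nabla_l u)_p^2$, and let $F=f+P_1-P_2$, where in the isotropic case $$P_1(u)=\tfrac{\mu}{2}\sum_{p\in\Omega}\big(|\nabla u|_p^2+\tfrac{\lambda}{\mu}\big),\qquad P_2(u)=\tfrac{\mu}{2}\sum_{p\in\Omega}\max\big(|\nabla u|_p^2,\tfrac{\lambda}{\mu}\big),$$ and in the anisotropic case $$P_1(u)=\tfrac{\mu}{2}\sum_{l=1}^2\sum_{p\in\Omega}\big((\nabla_l u)_p^2+\tfrac{\lambda}{\mu}\big),\qquad P_2(u)=\tfrac{\mu}{2}\sum_{l=1}^2\sum_{p\in\Omega}\max\big((\nabla_l u)_p^2,\tfrac{\lambda}{\mu}\big).$$ Thus $P_1-P_2$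 is the truncated quadratic regularization $\tfrac{\mu}{2}\sum_p\min(|\nabla u|_p^2,\tfrac{\lambda}{\mu})$, respectively $\tfrac{\mu}{2}\sum_l\sum_p\min((\nabla_l u)_p^2,\tfrac{\lambda}{\mu})$. Assume that $F$ is level-bounded, i.e. $\{u: F(u)\le\alpha\}$ is bounded for every $\alpha\in\mathbb{R}$. Let $L\ge 0$ be a Lipschitz constant of $\nabla f$ (here $\nabla f$ is the gradient of $f$), and let $M:X\to X$ be linear, self-adjoint and positive definite with $M\ge L I$; write $\|u\|_M^2=\langle u,Mu\rangle$. Let $(x^t)_{t\ge0}$ be generated by the preconditioned difference-of-convex algorithm with extrapolation (preDCA$_e$): $x^{-1}=x^0\in X$, $\beta_t\in[0,1)$ with $\sup_t\beta_t<1$, and for $t=0,1,2,\dots$ $$\xi^t\in\partial P_2(x^t),\qquad y^t=x^t+\beta_t(x^t-x^{t-1}),\qquad x^{t+1}=\operatorname*{arg\,min}_{z\in X}\Big\{\langle\nabla f(y^t)-\xi^t,z\rangle+\tfrac12\|z-y^t\|_M^2+P_1(z)\Big\},$$ where $\partial P_2$ is the convex subdifferential. Suppose that $x^t\to\bar x$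 for some $\bar x \in X$, and that $E(x,y)=F(x)+\tfrac12\|x-y\|_M^2$ on $X\times X$ is a Kurdyka-Łojasiewicz (KL) function with exponent $\tfrac12$, i.e. for every $\bar z$ with $\partial E(\bar z)\neq\emptyset$ there are $c>0$, $a\in(0,+\infty]$ and a neighbourhood $O$ of $\bar z$ such that, with $\psi(s)=c\,s^{1/2}$, $$\psi'\big(E(z)-E(\bar z)\big)\,\operatorname{dist}\big(0,\partial E(z)\big)\ge1\quad\text{for all } z\in O \text{ with } E(\bar z)<E(z)<E(\bar z)+a,$$ where $\partial E$ is the limiting subdifferential and $\operatorname{dist}(0,\emptyset)=+\infty$. Then there are $c_1>0$, an integer $t_0>0$ and $\eta\in(0,1)$ such that $\|x^t-\bar x\|<c_1\eta^t$ for all $t>t_0$; that is, $x^t$ converges to $\bar x$ locally linearly. -/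

import Mathlib

open Filter Topology
open scoped ENNReal NNReal RealInnerProductSpace

noncomputable section

/-! ### Subdifferentials -/

/-- The subdifferential of a finite-valued convex function, in the sense of convex analysis. -/
def convexSubdiff {V : Type*} [NormedAddCommGroup V] [InnerProductSpace ℝ V]
    (g : V → ℝ) (x : V) : Set V :=
  {ξ | ∀ y, g x + ⟪ξ, y - x⟫ ≤ g y}

/-- The Fréchet (regular) subdifferential: `ξ` such that
`liminf_{y → x, y ≠ x} (h y - h x - ⟨ξ, y - x⟩) / ‖y - x‖ ≥ 0`. -/
def frechetSubdiff {V : Type*} [NormedAddCommGroup V] [InnerProductSpace ℝ V]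
    (h : V → ℝ) (x : V) : Set V :=
  {ξ | ∀ ε : ℝ, 0 < ε → ∀ᶠ y in 𝓝[≠] x, -ε ≤ (h y - h x - ⟪ξ, y - x⟫) / ‖y - x‖}

/-- The limiting subdifferential: limits of Fréchet subgradients `ξₙ` of `h` at points `xₙ → x`
with `h xₙ → h x`. -/
def limitingSubdiff {V : Type*} [NormedAddCommGroup V] [InnerProductSpace ℝ V]
    (h : V → ℝ) (x : V) : Set V :=
  {ξ | ∃ (xs ξs : ℕ → V), Tendsto xs atTop (𝓝 x) ∧ Tendsto (fun n => h (xs n)) atTop (𝓝 (h x)) ∧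
    Tendsto ξs atTop (𝓝 ξ) ∧ ∀ n, ξs n ∈ frechetSubdiff h (xs n)}

/-! ### The Kurdyka-Łojasiewicz property -/

/-- `ψ` is a desingularizing function on `[0, a)`, where `a ∈ (0, +∞]`. -/
structure IsDesingularizing (a : ℝ≥0∞) (ψ : ℝ → ℝ) : Prop where
  pos : 0 < a
  zero : ψ 0 = 0
  continuousOn : ContinuousOn ψ {s | 0 ≤ s ∧ ENNReal.ofReal s < a}
  concaveOn : ConcaveOn ℝ {s | 0 ≤ s ∧ ENNReal.ofReal s < a} ψ
  differentiableAt : ∀ s, 0 < s → ENNReal.ofReal s < a → DifferentiableAt ℝ ψ s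
  continuousOn_deriv : ContinuousOn (deriv ψ) {s | 0 < s ∧ ENNReal.ofReal s < a}
  deriv_pos : ∀ s, 0 < s → ENNReal.ofReal s < a → 0 < deriv ψ s

/-- The KL inequality holds around `xbar` with the desingularizing function `ψ`:
`ψ'(h x - h xbar) * dist (0, ∂h x) ≥ 1` for all `x` near `xbar` with
`h xbar < h x < h xbar + a`. The distance to the empty set is `+∞`. -/
def KLAtWith {V : Type*} [NormedAddCommGroup V] [InnerProductSpace ℝ V]
    (h : V → ℝ) (xbar : V) (ψ : ℝ → ℝ) : Prop :=
  ∃ a : ℝ≥0∞, IsDesingularizing a ψ ∧ ∃ O ∈ 𝓝 xbar, ∀ x ∈ O, h xbar < h x →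
    ENNReal.ofReal (h x - h xbar) < a →
      1 ≤ ENNReal.ofReal (deriv ψ (h x - h xbar)) * Metric.infEDist 0 (limitingSubdiff h x)

/-- `h` is a KL function with exponent `θ`: it is closed, and at every point of `dom ∂h` the KL
property holds with `ψ s = c * s ^ (1 - θ)` for some `c > 0`. -/
def IsKLFunctionWithExponent {V : Type*} [NormedAddCommGroup V] [InnerProductSpace ℝ V]
    (h : V → ℝ) (θ : ℝ) : Prop :=
  LowerSemicontinuous h ∧
    ∀ xbar, (limitingSubdiff h xbar).Nonempty →
      ∃ c : ℝ, 0 < c ∧ KLAtWith h xbar (fun s => c * s ^ (1 - θ))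

/-! ### The truncated quadratic models -/

/-- The isotropic and the anisotropic truncated quadratic model. -/
inductive TQKind
  | iso
  | aniso

/-- Data of a truncated quadratic model on real images over a finite set `Ω` of pixels:
the operator `A` and the observation `u₀`, the two components `D 0`, `D 1` of the discrete gradient
(any linear operators, so every discretization and boundary condition is allowed), and the
parameters `μ, lam > 0`. -/
structure TQModel (Ω Y : Type*) [Fintype Ω] [NormedAddCommGroup Y] [InnerProductSpace ℝ Y] where
  A : EuclideanSpace ℝ Ω →L[ℝ] Y
  u₀ : Y
  D : Fin 2 → EuclideanSpace ℝ Ω →ₗ[ℝ] EuclideanSpace ℝ Ω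
  μ : ℝ
  lam : ℝ
  μ_pos : 0 < μ
  lam_pos : 0 < lam

namespace TQModel

variable {Ω Y : Type*} [Fintype Ω] [NormedAddCommGroup Y] [InnerProductSpace ℝ Y]

/-- The data term `f u = ‖A u - u₀‖² / 2`. -/
def f (m : TQModel Ω Y) (u : EuclideanSpace ℝ Ω) : ℝ :=
  ‖m.A u - m.u₀‖ ^ 2 / 2

/-- The squared length `|∇u|²` of the discrete gradient at the pixel `p`. -/
def gradSq (m : TQModel Ω Y) (u : EuclideanSpace ℝ Ω) (p : Ω) : ℝ :=
  ∑ l, (m.D l u p) ^ 2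

/-- The truncated quadratic regularization `P`, summed over the pixels. -/
def P (m : TQModel Ω Y) : TQKind → EuclideanSpace ℝ Ω → ℝ
  | .iso, u => m.μ / 2 * ∑ p, min (m.gradSq u p) (m.lam / m.μ)
  | .aniso, u => m.μ / 2 * ∑ l, ∑ p, min ((m.D l u p) ^ 2) (m.lam / m.μ)

/-- The first convex part in `P = P₁ - P₂`. -/
def P₁ (m : TQModel Ω Y) : TQKind → EuclideanSpace ℝ Ω → ℝ
  | .iso, u => m.μ / 2 * ∑ p, (m.gradSq u p + m.lam / m.μ)
  | .aniso, u => m.μ / 2 * ∑ l, ∑ p, ((m.D l u p) ^ 2 + m.lam / m.μ)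

/-- The second convex part in `P = P₁ - P₂`. -/
def P₂ (m : TQModel Ω Y) : TQKind → EuclideanSpace ℝ Ω → ℝ
  | .iso, u => m.μ / 2 * ∑ p, max (m.gradSq u p) (m.lam / m.μ)
  | .aniso, u => m.μ / 2 * ∑ l, ∑ p, max ((m.D l u p) ^ 2) (m.lam / m.μ)

/-- The objective `F = f + P`. -/
def F (m : TQModel Ω Y) (k : TQKind) (u : EuclideanSpace ℝ Ω) : ℝ :=
  m.f u + m.P k u

/-- The decomposition on which the algorithm is based. -/
theorem P_eq_sub (m : TQModel Ω Y) (k : TQKind) (u : EuclideanSpace ℝ Ω) :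
    m.P k u = m.P₁ k u - m.P₂ k u := by
  have key : ∀ a b : ℝ, min a b = (a + b) - max a b := fun a b => by
    linarith [min_add_max a b]
  cases k <;> simp only [P, P₁, P₂, key, Finset.sum_sub_distrib, mul_sub]

end TQModel

/-- `‖u‖_M² = ⟨u, M u⟩`. -/
def sqNormM {V : Type*} [NormedAddCommGroup V] [InnerProductSpace ℝ V]
    (M : V →ₗ[ℝ] V) (u : V) : ℝ :=
  ⟪u, M u⟫

/-- `M` is self-adjoint and positive definite. -/
structure IsMetricOp {V : Type*} [NormedAddCommGroup V] [InnerProductSpace ℝ V]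
    (M : V →ₗ[ℝ] V) : Prop where
  symm : M.IsSymmetric
  pos : ∀ u, u ≠ 0 → 0 < ⟪u, M u⟫

/-- The auxiliary function `E (x, y) = F x + ‖x - y‖_M² / 2` on the product `X × X` with its
Euclidean (`ℓ²`) structure. -/
def TQModel.E {Ω Y : Type*} [Fintype Ω] [NormedAddCommGroup Y] [InnerProductSpace ℝ Y]
    (m : TQModel Ω Y) (k : TQKind) (M : EuclideanSpace ℝ Ω →ₗ[ℝ] EuclideanSpace ℝ Ω)
    (z : WithLp 2 (EuclideanSpace ℝ Ω × EuclideanSpace ℝ Ω)) : ℝ :=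
  m.F k z.fst + sqNormM M (z.fst - z.snd) / 2

/-- `F` is level-bounded: all its sublevel sets are bounded. -/
def LevelBounded {V : Type*} [NormedAddCommGroup V] (F : V → ℝ) : Prop :=
  ∀ α : ℝ, Bornology.IsBounded {u | F u ≤ α}

/-- The sequences `x, y, ξ` are generated by the preconditioned difference-of-convex algorithm with
extrapolation, with metric `M` and extrapolation parameters `β`. The convention `x⁻¹ = x⁰` is
expressed by the truncated subtraction `0 - 1 = 0` on natural numbers. -/
structure IsPreDCAe {Ω Y : Type*} [Fintype Ω] [NormedAddCommGroup Y] [InnerProductSpace ℝ Y]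
    (m : TQModel Ω Y) (k : TQKind) (M : EuclideanSpace ℝ Ω →ₗ[ℝ] EuclideanSpace ℝ Ω)
    (β : ℕ → ℝ) (x y ξ : ℕ → EuclideanSpace ℝ Ω) : Prop where
  β_mem : ∀ t, β t ∈ Set.Ico (0 : ℝ) 1
  β_sup : (⨆ t, β t) < 1
  ξ_mem : ∀ t, ξ t ∈ convexSubdiff (m.P₂ k) (x t)
  y_eq : ∀ t, y t = x t + β t • (x t - x (t - 1))
  x_argmin : ∀ t, IsMinOn
    (fun z => ⟪gradient m.f (y t) - ξ t, z⟫ + sqNormM M (z - y t) / 2 + m.P₁ k z)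
    Set.univ (x (t + 1))

end

/-!
Since the truncated regularization `P` is bounded, level-boundedness of `F = f + P` forces `A` to be
injective, so `f` is strongly convex. A minimum `min q τ` of a convex function and a constant has a
convexity property that survives at its kinks: if `x` is close to `a`, then the convexity inequality
at `x` holds along a short extension of the segment from `a` to `x`. Hence, for `x` near the limit
`a` and every `ξ ∈ ∂P₂(x)`,
`F x - F a + κ/2 ‖x - a‖² ≤ ⟨∇f x + ∇P₁ x - ξ, x - a⟩`.
At an iterate the optimality condition of the subproblem bounds this residual by the lengths of two
consecutive steps, and Young's inequality turns this into a quadratic growth estimate. Combined with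
the descent property, it contracts the energy `F(xᵗ) - F(a) + s ‖xᵗ - xᵗ⁻¹‖_M² / 2` by a fixed
factor, for any weight `s` strictly between `sup β` and `1`.
-/

open Set

section RealSequences

theorem exists_lt_mul_pow_of_contraction {e h : ℕ → ℝ} {c K : ℝ} (hc : 0 < c) (hK : 0 < K)
    (h_nonneg : ∀ t, 0 ≤ h t)
    (h_contr : ∀ᶠ t in atTop, h t + c * e t ^ 2 ≤ K * (h t - h (t + 1))) :
    ∃ c₁ : ℝ, 0 < c₁ ∧ ∃ t₀ : ℕ, 0 < t₀ ∧ ∃ η ∈ Ioo (0 : ℝ) 1, ∀ t, t₀ < t → e t < c₁ * η ^ t := by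
  obtain ⟨T, hT⟩ := eventually_atTop.1 h_contr
  set q := K / (K + 1)
  have hq : 0 < q := by positivity
  have hq_lt : q < 1 := (div_lt_one (by positivity)).2 (lt_add_one K)
  have h_step : ∀ t, T ≤ t → h (t + 1) ≤ q * h t := fun t ht => by
    have h_key := hT t ht
    have h_sq : 0 ≤ c * e t ^ 2 := by positivity
    have h_anti : 0 ≤ h t - h (t + 1) :=
      nonneg_of_mul_nonneg_right (by linarith [h_nonneg t]) hK
    rw [div_mul_eq_mul_div, le_div_iff₀ (by positivity)]
    linarith
  have h_geom : ∀ t, T ≤ t → h t ≤ h T / q ^ T * q ^ t := fun t ht => by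
    obtain ⟨n, rfl⟩ := Nat.exists_eq_add_of_le ht
    have := le_geom (u := fun n => h (T + n)) hq.le n fun k _ => h_step (T + k) (by lia)
    rw [pow_add, ← mul_assoc, div_mul_cancel₀ _ (by positivity), mul_comm]
    exact this
  set G := K * (h T / q ^ T) / c
  have hG : 0 ≤ G := by have := h_nonneg T; positivity
  refine ⟨√G + 1, by positivity, T + 1, Nat.succ_pos T, √q,
    ⟨Real.sqrt_pos.2 hq, by rwa [Real.sqrt_lt' one_pos, one_pow]⟩, fun t ht => ?_⟩
  have h_sq : e t ^ 2 ≤ (√G * √q ^ t) ^ 2 := by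
    have h_key := hT t (by lia)
    have h_decay := mul_le_mul_of_nonneg_left (h_geom t (by lia)) hK.le
    have h_next := mul_nonneg hK.le (h_nonneg (t + 1))
    rw [mul_pow, ← pow_mul, mul_comm t, pow_mul, Real.sq_sqrt hG, Real.sq_sqrt hq.le,
      div_mul_eq_mul_div, le_div_iff₀ hc]
    linarith [h_nonneg t]
  have h_le : e t ≤ √G * √q ^ t := le_of_sq_le_sq h_sq (by positivity)
  have h_pos : 0 < √q ^ t := by positivity
  linarith

/-- The weight `(1 + b) / 2` on `d` lies strictly between `b` and `1`, so that one step of the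
descent inequality controls both `d t` and `d (t + 1)`. -/
theorem exists_lt_mul_pow_of_descent_of_growth {e Φ d : ℕ → ℝ} {b c C : ℝ} (hb : b < 1)
    (hc : 0 < c) (hC : 0 ≤ C) (hd : ∀ t, 0 ≤ d t)
    (h_descent : ∀ t, Φ (t + 1) + d (t + 1) ≤ Φ t + b * d t)
    (h_growth : ∀ᶠ t in atTop, Φ t + c * e t ^ 2 ≤ C * (d t + d (t + 1)))
    (hΦ_lim : Tendsto Φ atTop (𝓝 0)) (hd_lim : Tendsto d atTop (𝓝 0)) :
    ∃ c₁ : ℝ, 0 < c₁ ∧ ∃ t₀ : ℕ, 0 < t₀ ∧ ∃ η ∈ Ioo (0 : ℝ) 1, ∀ t, t₀ < t → e t < c₁ * η ^ t := by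
  set h : ℕ → ℝ := fun t => Φ t + (1 + b) / 2 * d t with h_def
  set δ := (1 - b) / 2 with δ_def
  have hδ : 0 < δ := half_pos (sub_pos.2 hb)
  have h_decr : ∀ t, δ * (d t + d (t + 1)) ≤ h t - h (t + 1) := fun t => by
    simp only [h_def, δ_def]
    linarith [h_descent t]
  have h_anti : Antitone h := antitone_nat_of_succ_le fun t => by
    have := mul_nonneg hδ.le (add_nonneg (hd t) (hd (t + 1)))
    linarith [h_decr t]
  have h_lim : Tendsto h atTop (𝓝 0) := by
    simpa only [mul_zero, add_zero] using hΦ_lim.add (hd_lim.const_mul ((1 + b) / 2))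
  refine exists_lt_mul_pow_of_contraction (K := (C + 1) / δ) hc (by positivity)
    (h_anti.le_of_tendsto h_lim) ?_
  filter_upwards [h_growth] with t ht
  have h_weight : (1 + b) / 2 * d t ≤ d t := mul_le_of_le_one_left (hd t) (by linarith)
  calc h t + c * e t ^ 2 ≤ (C + 1) * (d t + d (t + 1)) := by
        simp only [h_def]
        linarith [hd (t + 1)]
    _ = (C + 1) / δ * (δ * (d t + d (t + 1))) := by field_simp
    _ ≤ (C + 1) / δ * (h t - h (t + 1)) :=
      mul_le_mul_of_nonneg_left (h_decr t) (by positivity)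

end RealSequences

section RadialConvexity

variable {V : Type*} [AddCommGroup V] [Module ℝ V]

theorem one_add_mul_le_of_convexOn {q : V → ℝ} (hq : ConvexOn ℝ univ q) (a x : V) {ε : ℝ}
    (hε : 0 < ε) : (1 + ε) * q x ≤ q (x + ε • (x - a)) + ε * q a := by
  have h_conv := hq.2 (mem_univ (x + ε • (x - a))) (mem_univ a)
    (show 0 ≤ (1 + ε)⁻¹ by positivity) (show 0 ≤ ε * (1 + ε)⁻¹ by positivity) (by field_simp)
  have hx : (1 + ε)⁻¹ • (x + ε • (x - a)) + (ε * (1 + ε)⁻¹) • a = x := by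
    match_scalars
    · field_simp
    · field_simp
      ring
  rw [hx, smul_eq_mul, smul_eq_mul] at h_conv
  calc (1 + ε) * q x
      ≤ (1 + ε) * ((1 + ε)⁻¹ * q (x + ε • (x - a)) + ε * (1 + ε)⁻¹ * q a) := by gcongr
    _ = q (x + ε • (x - a)) + ε * q a := by field_simp

variable [TopologicalSpace V]

/-- Local convexity of `P` on segments issuing from `a`: for `x` near `a`, the convexity inequality
holds at `x` as a point between `a` and any point slightly beyond `x`. How far beyond may depend
on `x`; this admits functions like `min q τ` that are not convex in any neighbourhood of `a`. -/
def RadiallyConvexNear (P : V → ℝ) (a : V) : Prop :=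
  ∀ᶠ x in 𝓝 a, ∀ᶠ ε in 𝓝[>] (0 : ℝ), (1 + ε) * P x ≤ P (x + ε • (x - a)) + ε * P a

namespace RadiallyConvexNear

theorem const_mul {P : V → ℝ} {a : V} (hP : RadiallyConvexNear P a) {c : ℝ} (hc : 0 ≤ c) :
    RadiallyConvexNear (fun u => c * P u) a := by
  filter_upwards [hP] with x hx
  filter_upwards [hx] with ε hε
  linarith [mul_le_mul_of_nonneg_left hε hc]

theorem sum {ι : Type*} [Fintype ι] {P : ι → V → ℝ} {a : V}
    (hP : ∀ i, RadiallyConvexNear (P i) a) : RadiallyConvexNear (fun u => ∑ i, P i u) a := by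
  filter_upwards [eventually_all.2 hP] with x hx
  filter_upwards [eventually_all.2 hx] with ε hε
  simpa only [Finset.mul_sum, ← Finset.sum_add_distrib] using
    Finset.sum_le_sum fun i _ => hε i

end RadiallyConvexNear

/-- Either `min q τ` agrees with `q` at `a`, `x` and slightly beyond `x`, or with `τ`, or
`q a = q x = τ`; in the last case convexity of `q` gives `q ≥ τ` beyond `x`. -/
theorem radiallyConvexNear_min [ContinuousAdd V] [ContinuousSMul ℝ V] {q : V → ℝ}
    (hq : ConvexOn ℝ univ q) (hq_cont : Continuous q) (τ : ℝ) (a : V) :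
    RadiallyConvexNear (fun u => min (q u) τ) a := by
  have h_above : ∀ᶠ x in 𝓝 a, τ < q a → τ < q x := by
    rw [eventually_imp_distrib_left]
    exact fun h => hq_cont.continuousAt.eventually_const_lt h
  have h_below : ∀ᶠ x in 𝓝 a, q a < τ → q x < τ := by
    rw [eventually_imp_distrib_left]
    exact fun h => hq_cont.continuousAt.eventually_lt_const h
  filter_upwards [h_above, h_below] with x hx_above hx_below
  have h_ray : Tendsto (fun ε : ℝ => q (x + ε • (x - a))) (𝓝[>] 0) (𝓝 (q x)) := by
    have : Continuous fun ε : ℝ => q (x + ε • (x - a)) := by fun_prop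
    simpa using (this.tendsto 0).mono_left nhdsWithin_le_nhds
  rcases lt_trichotomy (q x) τ with h | h | h
  · have ha : q a ≤ τ := not_lt.1 fun h' => (hx_above h').not_gt h
    filter_upwards [h_ray.eventually_lt_const h, self_mem_nhdsWithin] with ε h_beyond hε
    rw [min_eq_left h.le, min_eq_left h_beyond.le, min_eq_left ha]
    exact one_add_mul_le_of_convexOn hq a x hε
  · have ha : q a = τ :=
      le_antisymm (not_lt.1 fun h' => (hx_above h').ne' h) (not_lt.1 fun h' => (hx_below h').ne h)
    filter_upwards [self_mem_nhdsWithin] with ε hε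
    have h_beyond : τ ≤ q (x + ε • (x - a)) := by
      have := one_add_mul_le_of_convexOn hq a x hε
      rw [h, ha] at this
      linarith
    rw [h, ha, min_self, min_eq_right h_beyond]
    linarith
  · have ha : τ ≤ q a := not_lt.1 fun h' => (hx_below h').not_gt h
    filter_upwards [h_ray.eventually_const_lt h] with ε h_beyond
    rw [min_eq_right h.le, min_eq_right h_beyond.le, min_eq_right ha]
    linarith

theorem RadiallyConvexNear.eventually_sub_le_inner {V : Type*} [NormedAddCommGroup V]
    [InnerProductSpace ℝ V] [CompleteSpace V] {P₁ P₂ : V → ℝ} {a : V}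
    (hP : RadiallyConvexNear (fun u => P₁ u - P₂ u) a) :
    ∀ᶠ x in 𝓝 a, ∀ p ξ, HasGradientAt P₁ p x → ξ ∈ convexSubdiff P₂ x →
      P₁ x - P₂ x - (P₁ a - P₂ a) ≤ ⟪p - ξ, x - a⟫ := by
  filter_upwards [hP] with x hx p ξ hp hξ
  have h_slope : Tendsto (fun ε : ℝ => ε⁻¹ • (P₁ (x + ε • (x - a)) - P₁ x) - ⟪ξ, x - a⟫) (𝓝[>] 0)
      (𝓝 (⟪p, x - a⟫ - ⟪ξ, x - a⟫)) := by
    have := (hp.hasFDerivAt.hasLineDerivAt (x - a)).tendsto_slope_zero_right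
    exact this.sub_const _
  rw [inner_sub_left]
  refine ge_of_tendsto h_slope ?_
  filter_upwards [hx, self_mem_nhdsWithin] with ε h_conv hε
  have h_subgrad := hξ (x + ε • (x - a))
  rw [add_sub_cancel_left, real_inner_smul_right] at h_subgrad
  rw [smul_eq_mul, le_sub_iff_add_le, le_inv_mul_iff₀ hε]
  linarith

end RadialConvexity

section InnerProductSpace

variable {V : Type*} [NormedAddCommGroup V] [InnerProductSpace ℝ V] {M : V →ₗ[ℝ] V}

theorem sqNormM_add (hM : M.IsSymmetric) (x v : V) :
    sqNormM M (x + v) = sqNormM M x + 2 * ⟪M x, v⟫ + sqNormM M v := by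
  have h_symm : ⟪x, M v⟫ = ⟪M x, v⟫ := (hM x v).symm
  have h_comm : ⟪v, M x⟫ = ⟪M x, v⟫ := real_inner_comm _ _
  simp only [sqNormM, map_add, inner_add_left, inner_add_right, h_symm, h_comm]
  ring

theorem sqNormM_smul (M : V →ₗ[ℝ] V) (c : ℝ) (x : V) : sqNormM M (c • x) = c ^ 2 * sqNormM M x := by
  simp only [sqNormM, map_smul, real_inner_smul_left, real_inner_smul_right]
  ring

theorem sqNormM_sub_comm (M : V →ₗ[ℝ] V) (x y : V) : sqNormM M (x - y) = sqNormM M (y - x) := by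
  simp only [sqNormM, ← neg_sub y x, map_neg, inner_neg_neg]

theorem hasGradientAt_sqNormM_sub_div_two [CompleteSpace V] (hM : M.IsSymmetric) (y w : V) :
    HasGradientAt (fun z => sqNormM M (z - y) / 2) (M (w - y)) w := by
  let T : V →L[ℝ] V := ⟨M, hM.continuous⟩
  have hT : (T : V →ₗ[ℝ] V).IsSymmetric := hM
  have h_deriv : HasFDerivAt (fun z => (2 : ℝ)⁻¹ * T.reApplyInnerSelf (z - y))
      ((2 : ℝ)⁻¹ • (2 • innerSL ℝ (T (w - y)))) w :=
    ((hT.hasStrictFDerivAt_reApplyInnerSelf (w - y)).hasFDerivAt.comp w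
      ((hasFDerivAt_id w).sub_const y)).const_mul _
  rw [hasGradientAt_iff_hasFDerivAt]
  convert! h_deriv using 1
  · ext z
    rw [sqNormM, real_inner_comm, div_eq_inv_mul]
    rfl
  · ext v
    simp [T]

theorem gradient_add_eq_zero_of_isMinOn [CompleteSpace V] (hM : M.IsSymmetric) {φ : V → ℝ}
    {g p w y : V} (hφ : HasGradientAt φ p w)
    (hw : IsMinOn (fun z => ⟪g, z⟫ + sqNormM M (z - y) / 2 + φ z) univ w) :
    g + M (w - y) + p = 0 := by
  have h_deriv := ((innerSL ℝ g).hasFDerivAt (x := w)).add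
    (hasGradientAt_sqNormM_sub_div_two hM y w).hasFDerivAt |>.add hφ.hasFDerivAt
  have h_zero := (hw.isLocalMin univ_mem).hasFDerivAt_eq_zero h_deriv
  refine ext_inner_right ℝ fun v => ?_
  simpa [inner_add_left, -map_sub] using DFunLike.congr_fun h_zero v

/-- The descent property of one step of the algorithm, which leads from `x` with extrapolation `y`
to `w`. -/
theorem add_sqNormM_le_of_step (hM : M.IsSymmetric) {f P₁ P₂ : V → ℝ} {g p ξ w x y : V}
    (hf_upper : f w ≤ f y + ⟪g, w - y⟫ + sqNormM M (w - y) / 2) (hg : g ∈ convexSubdiff f y)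
    (hp : p ∈ convexSubdiff P₁ w) (hξ : ξ ∈ convexSubdiff P₂ x)
    (h_opt : g - ξ + M (w - y) + p = 0) :
    f w + (P₁ w - P₂ w) + sqNormM M (w - x) / 2 ≤
      f x + (P₁ x - P₂ x) + sqNormM M (x - y) / 2 := by
  have h_expand := sqNormM_add hM (w - y) (x - w)
  rw [add_comm (w - y), sub_add_sub_cancel, sqNormM_sub_comm M x w] at h_expand
  have h_test : ⟪g - ξ + M (w - y) + p, x - w⟫ = 0 := by rw [h_opt, inner_zero_left]
  have h_split : ⟪g, x - w⟫ = ⟪g, x - y⟫ - ⟪g, w - y⟫ := by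
    rw [← inner_sub_right, sub_sub_sub_cancel_right]
  have h_swap : ⟪ξ, w - x⟫ = -⟪ξ, x - w⟫ := by rw [← inner_neg_right, neg_sub]
  rw [inner_add_left, inner_add_left, inner_sub_left, h_split] at h_test
  have hf_lower := hg x
  have hP₁ := hp x
  have hP₂ := hξ w
  linarith

theorem add_mul_sq_norm_le_of_le_inner {Φ κ : ℝ} (hκ : 0 < κ) {r e : V}
    (h : Φ + κ / 2 * ‖e‖ ^ 2 ≤ ⟪r, e⟫) : Φ + κ / 4 * ‖e‖ ^ 2 ≤ ‖r‖ ^ 2 / κ := by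
  have h_young : ‖r‖ * ‖e‖ ≤ κ / 4 * ‖e‖ ^ 2 + ‖r‖ ^ 2 / κ := by
    have h_sq : 0 ≤ (κ / 2 * ‖e‖ - ‖r‖) ^ 2 / κ := by positivity
    have h_expand : (κ / 2 * ‖e‖ - ‖r‖) ^ 2 / κ =
        κ / 4 * ‖e‖ ^ 2 + ‖r‖ ^ 2 / κ - ‖r‖ * ‖e‖ := by
      field_simp
      ring
    linarith
  linarith [real_inner_le_norm r e]

end InnerProductSpace

section NormedSpace

variable {V W : Type*} [NormedAddCommGroup V] [NormedSpace ℝ V] [NormedAddCommGroup W]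
  [NormedSpace ℝ W]

theorem norm_residual_le {G p : V → V} {L L₁ : ℝ≥0} (hG : LipschitzWith L G)
    (hp : LipschitzWith L₁ p) (M : V →L[ℝ] V) {w x y ξ : V}
    (h_opt : G y - ξ + M (w - y) + p w = 0) :
    ‖G x + p x - ξ‖ ≤ (L + L₁ + ‖M‖) * (‖w - x‖ + ‖x - y‖) := by
  have h_eq : G x + p x - ξ = (G x - G y) + (p x - p w) - M (w - y) := by
    rw [← sub_eq_zero]
    refine Eq.trans ?_ h_opt
    abel
  have hG_le : ‖G x - G y‖ ≤ L * (‖w - x‖ + ‖x - y‖) :=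
    (hG.norm_sub_le x y).trans (by gcongr; linarith [norm_nonneg (w - x)])
  have hp_le : ‖p x - p w‖ ≤ L₁ * (‖w - x‖ + ‖x - y‖) :=
    (hp.norm_sub_le x w).trans (by rw [norm_sub_rev]; gcongr; linarith [norm_nonneg (x - y)])
  have hM_le : ‖M (w - y)‖ ≤ ‖M‖ * (‖w - x‖ + ‖x - y‖) :=
    (M.le_opNorm _).trans (by gcongr; exact norm_sub_le_norm_sub_add_norm_sub w x y)
  calc ‖G x + p x - ξ‖ ≤ ‖G x - G y‖ + ‖p x - p w‖ + ‖M (w - y)‖ := by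
        rw [h_eq]
        exact (norm_sub_le _ _).trans (add_le_add_left (norm_add_le _ _) _)
    _ ≤ (L + L₁ + ‖M‖) * (‖w - x‖ + ‖x - y‖) := by linarith

theorem exists_pos_mul_sq_norm_le [FiniteDimensional ℝ V] {A : V →ₗ[ℝ] W}
    (hA : LinearMap.ker A = ⊥) : ∃ κ : ℝ, 0 < κ ∧ ∀ u, κ * ‖u‖ ^ 2 ≤ ‖A u‖ ^ 2 := by
  obtain ⟨K, hK_pos, hK⟩ := A.exists_antilipschitzWith hA
  have : (0 : ℝ) < K := hK_pos
  refine ⟨((K : ℝ) ^ 2)⁻¹, by positivity, fun u => ?_⟩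
  have h_norm : ‖u‖ ≤ K * ‖A u‖ := by simpa using hK.le_mul_dist u 0
  rw [inv_mul_le_iff₀ (by positivity), ← mul_pow]
  gcongr

theorem LevelBounded.eq_zero_of_forall_smul_le {F : V → ℝ} (hF : LevelBounded F) {u : V} {α : ℝ}
    (hu : ∀ s : ℝ, F (s • u) ≤ α) : u = 0 := by
  by_contra hne
  obtain ⟨R, hR⟩ := (hF α).exists_norm_le
  obtain ⟨n, hn⟩ := exists_nat_gt (R / ‖u‖)
  have h_le := hR _ (hu n)
  rw [norm_smul, Real.norm_natCast] at h_le
  rw [div_lt_iff₀ (norm_pos_iff.2 hne)] at hn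
  linarith

end NormedSpace

namespace TQModel

variable {Ω Y : Type*} [Fintype Ω] [NormedAddCommGroup Y] [InnerProductSpace ℝ Y]
  (m : TQModel Ω Y) (k : TQKind)

section DataTerm

theorem inner_gradient_f (u v : EuclideanSpace ℝ Ω) :
    ⟪gradient m.f u, v⟫ = ⟪m.A u - m.u₀, m.A v⟫ := by
  have h_deriv : HasFDerivAt m.f
      ((2 : ℝ)⁻¹ • (2 • (innerSL ℝ (m.A u - m.u₀)).comp m.A)) u := by
    have h_norm := (m.A.hasFDerivAt.sub_const m.u₀ (x := u)).norm_sq.const_mul (2 : ℝ)⁻¹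
    exact h_norm.congr_of_eventuallyEq (.of_forall fun z => div_eq_inv_mul _ _)
  rw [inner_gradient_left, h_deriv.fderiv]
  simp [inner_sub_left]

theorem f_eq_add (u v : EuclideanSpace ℝ Ω) :
    m.f v = m.f u + ⟪gradient m.f u, v - u⟫ + ‖m.A (v - u)‖ ^ 2 / 2 := by
  have h_sub : m.A v - m.u₀ = (m.A u - m.u₀) + m.A (v - u) := by rw [map_sub]; abel
  rw [inner_gradient_f, f, f, h_sub, norm_add_sq_real]
  ring

theorem gradient_f_mem_convexSubdiff (u : EuclideanSpace ℝ Ω) :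
    gradient m.f u ∈ convexSubdiff m.f u := fun v => by
  have := sq_nonneg ‖m.A (v - u)‖
  linarith [m.f_eq_add u v]

theorem sq_norm_A_le {L : ℝ≥0} (hL : LipschitzWith L (gradient m.f)) (v : EuclideanSpace ℝ Ω) :
    ‖m.A v‖ ^ 2 ≤ L * ‖v‖ ^ 2 :=
  calc ‖m.A v‖ ^ 2 = ⟪gradient m.f v - gradient m.f 0, v⟫ := by
        rw [inner_sub_left, inner_gradient_f, inner_gradient_f, ← inner_sub_left]
        simp
    _ ≤ ‖gradient m.f v - gradient m.f 0‖ * ‖v‖ := real_inner_le_norm _ _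
    _ ≤ L * ‖v‖ * ‖v‖ := by
        gcongr
        simpa using hL.norm_sub_le v 0
    _ = L * ‖v‖ ^ 2 := by ring

end DataTerm

section Regularization

/-- The linear operator `μ ∑ₗ ∇ₗᵀ ∇ₗ`, the Hessian of the quadratic function `P₁` in both models. -/
noncomputable def hessP₁ : EuclideanSpace ℝ Ω →ₗ[ℝ] EuclideanSpace ℝ Ω :=
  m.μ • ∑ l, (m.D l).adjoint * m.D l

theorem isSymmetric_hessP₁ : m.hessP₁.IsSymmetric :=
  (LinearMap.isSymmetric_sum _ fun l _ => (m.D l).isSymmetric_adjoint_mul_self).smul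
    (RCLike.conj_to_real)

theorem sqNormM_hessP₁ (u : EuclideanSpace ℝ Ω) :
    sqNormM m.hessP₁ u = m.μ * ∑ l, ‖m.D l u‖ ^ 2 := by
  simp only [sqNormM, hessP₁, LinearMap.smul_apply, LinearMap.sum_apply, Module.End.mul_apply,
    real_inner_smul_right, inner_sum, LinearMap.adjoint_inner_right, real_inner_self_eq_norm_sq]

theorem P₁_eq_sqNormM_add (u : EuclideanSpace ℝ Ω) :
    m.P₁ k u = sqNormM m.hessP₁ u / 2 + m.P₁ k 0 := by
  have h_zero : ∀ l p, m.D l 0 p = 0 := fun l p => by rw [map_zero, PiLp.zero_apply]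
  rw [sqNormM_hessP₁]
  cases k
  · simp only [P₁, gradSq, Finset.sum_add_distrib, EuclideanSpace.real_norm_sq_eq, h_zero,
      zero_pow two_ne_zero, Finset.sum_const_zero]
    rw [Finset.sum_comm]
    ring
  · simp only [P₁, Finset.sum_add_distrib, EuclideanSpace.real_norm_sq_eq, h_zero,
      zero_pow two_ne_zero, Finset.sum_const_zero]
    ring

theorem hasGradientAt_P₁ (u : EuclideanSpace ℝ Ω) : HasGradientAt (m.P₁ k) (m.hessP₁ u) u := by
  have h_quad := hasGradientAt_sqNormM_sub_div_two m.isSymmetric_hessP₁ 0 u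
  simp only [sub_zero] at h_quad
  rw [funext (m.P₁_eq_sqNormM_add k), hasGradientAt_iff_hasFDerivAt]
  exact h_quad.hasFDerivAt.add_const _

theorem hessP₁_mem_convexSubdiff (u : EuclideanSpace ℝ Ω) :
    m.hessP₁ u ∈ convexSubdiff (m.P₁ k) u := fun v => by
  have h_expand := sqNormM_add m.isSymmetric_hessP₁ u (v - u)
  have h_nonneg : 0 ≤ sqNormM m.hessP₁ (v - u) := by
    have := m.μ_pos
    rw [sqNormM_hessP₁]
    positivity
  rw [add_sub_cancel] at h_expand
  rw [P₁_eq_sqNormM_add m k u, P₁_eq_sqNormM_add m k v]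
  linarith

theorem convexOn_D_sq (l : Fin 2) (p : Ω) : ConvexOn ℝ univ fun u => (m.D l u p) ^ 2 :=
  (even_two.convexOn_pow (𝕜 := ℝ)).comp_linearMap (EuclideanSpace.projₗ (𝕜 := ℝ) p ∘ₗ m.D l)

theorem convexOn_gradSq (p : Ω) : ConvexOn ℝ univ fun u => m.gradSq u p := by
  simp only [gradSq, Fin.sum_univ_two]
  exact (m.convexOn_D_sq 0 p).add (m.convexOn_D_sq 1 p)

theorem radiallyConvexNear_P (a : EuclideanSpace ℝ Ω) : RadiallyConvexNear (m.P k) a := by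
  have hμ : 0 ≤ m.μ / 2 := (half_pos m.μ_pos).le
  cases k
  · exact .const_mul (.sum fun p => radiallyConvexNear_min (m.convexOn_gradSq p)
      (m.convexOn_gradSq p).locallyLipschitz.continuous _ a) hμ
  · exact .const_mul (.sum fun l => .sum fun p => radiallyConvexNear_min (m.convexOn_D_sq l p)
      (m.convexOn_D_sq l p).locallyLipschitz.continuous _ a) hμ

theorem bddAbove_range_P : BddAbove (range (m.P k)) := by
  have hμ : 0 ≤ m.μ / 2 := (half_pos m.μ_pos).le
  cases k
  · refine ⟨m.μ / 2 * ∑ _p : Ω, m.lam / m.μ, forall_mem_range.2 fun u => ?_⟩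
    exact mul_le_mul_of_nonneg_left (Finset.sum_le_sum fun _ _ => min_le_right _ _) hμ
  · refine ⟨m.μ / 2 * ∑ _l : Fin 2, ∑ _p : Ω, m.lam / m.μ, forall_mem_range.2 fun u => ?_⟩
    exact mul_le_mul_of_nonneg_left
      (Finset.sum_le_sum fun _ _ => Finset.sum_le_sum fun _ _ => min_le_right _ _) hμ

end Regularization

section Objective

theorem continuous_F : Continuous (m.F k) := by
  have : ∀ l p, Continuous fun u => m.D l u p := fun l p =>
    (EuclideanSpace.projₗ p ∘ₗ m.D l).continuous_of_finiteDimensional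
  have hf : Continuous m.f := by unfold f; fun_prop
  have hP : Continuous (m.P k) := by
    cases k
    · change Continuous fun u => m.P .iso u
      simp only [P, gradSq]
      fun_prop
    · change Continuous fun u => m.P .aniso u
      simp only [P]
      fun_prop
  exact hf.add hP

theorem ker_A_eq_bot_of_levelBounded {k : TQKind} (hF : LevelBounded (m.F k)) :
    LinearMap.ker m.A.toLinearMap = ⊥ := by
  refine LinearMap.ker_eq_bot'.2 fun u hu => ?_
  obtain ⟨C, hC⟩ := m.bddAbove_range_P k
  have hAu : m.A u = 0 := hu
  refine hF.eq_zero_of_forall_smul_le (α := ‖m.u₀‖ ^ 2 / 2 + C) fun s => ?_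
  have hf : m.f (s • u) = ‖m.u₀‖ ^ 2 / 2 := by simp [f, hAu]
  rw [F, hf]
  exact add_le_add_right (hC (mem_range_self _)) _

theorem eventually_F_sub_le_inner (a : EuclideanSpace ℝ Ω) :
    ∀ᶠ x in 𝓝 a, ∀ ξ ∈ convexSubdiff (m.P₂ k) x,
      m.F k x - m.F k a + ‖m.A (x - a)‖ ^ 2 / 2 ≤
        ⟪gradient m.f x + m.hessP₁ x - ξ, x - a⟫ := by
  have h_radial := m.radiallyConvexNear_P k a
  rw [funext (m.P_eq_sub k)] at h_radial
  filter_upwards [h_radial.eventually_sub_le_inner] with x hx ξ hξ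
  have hP := hx _ ξ (m.hasGradientAt_P₁ k x) hξ
  have hf := m.f_eq_add x a
  rw [← neg_sub x a, map_neg, norm_neg, inner_neg_right] at hf
  rw [add_sub_assoc, inner_add_left]
  simp only [F, P_eq_sub]
  linarith

end Objective

end TQModel

/-- The energy `‖xᵗ - xᵗ⁻¹‖_M² / 2` of the step that leads to `xᵗ`, with `x⁻¹ = x⁰`. -/
noncomputable def stepEnergy {V : Type*} [NormedAddCommGroup V] [InnerProductSpace ℝ V]
    (M : V →ₗ[ℝ] V) (x : ℕ → V) (t : ℕ) : ℝ :=
  sqNormM M (x t - x (t - 1)) / 2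

theorem tendsto_stepEnergy_zero {V : Type*} [NormedAddCommGroup V] [InnerProductSpace ℝ V]
    {M : V →ₗ[ℝ] V} (hM : Continuous M) {x : ℕ → V} {a : V} (hx : Tendsto x atTop (𝓝 a)) :
    Tendsto (stepEnergy M x) atTop (𝓝 0) := by
  have h_step : Tendsto (fun t => x t - x (t - 1)) atTop (𝓝 0) := by
    simpa using hx.sub (hx.comp (tendsto_sub_atTop_nat 1))
  have h_cont : Continuous fun u => sqNormM M u / 2 := by
    unfold sqNormM
    fun_prop
  have h_zero : sqNormM M 0 / 2 = 0 := by simp [sqNormM]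
  exact h_zero ▸ (h_cont.tendsto 0).comp h_step

namespace IsPreDCAe

variable {Ω Y : Type*} [Fintype Ω] [NormedAddCommGroup Y] [InnerProductSpace ℝ Y]
  {m : TQModel Ω Y} {k : TQKind} {M : EuclideanSpace ℝ Ω →ₗ[ℝ] EuclideanSpace ℝ Ω}
  {β : ℕ → ℝ} {x y ξ : ℕ → EuclideanSpace ℝ Ω}

theorem sub_extrapolation_eq (hx : IsPreDCAe m k M β x y ξ) (t : ℕ) :
    x t - y t = (-β t) • (x t - x (t - 1)) := by
  rw [hx.y_eq, neg_smul]
  abel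

theorem norm_sub_extrapolation_le (hx : IsPreDCAe m k M β x y ξ) (t : ℕ) :
    ‖x t - y t‖ ≤ ‖x t - x (t - 1)‖ := by
  rw [hx.sub_extrapolation_eq, norm_smul, norm_neg, Real.norm_of_nonneg (hx.β_mem t).1]
  exact mul_le_of_le_one_left (norm_nonneg _) (hx.β_mem t).2.le

theorem sq_beta_le_iSup (hx : IsPreDCAe m k M β x y ξ) (t : ℕ) : β t ^ 2 ≤ ⨆ t, β t := by
  have h_bdd : BddAbove (range β) := ⟨1, forall_mem_range.2 fun t => (hx.β_mem t).2.le⟩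
  exact (pow_le_of_le_one (hx.β_mem t).1 (hx.β_mem t).2.le two_ne_zero).trans (le_ciSup h_bdd t)

theorem optimality (hx : IsPreDCAe m k M β x y ξ) (hM : M.IsSymmetric) (t : ℕ) :
    gradient m.f (y t) - ξ t + M (x (t + 1) - y t) + m.hessP₁ (x (t + 1)) = 0 :=
  gradient_add_eq_zero_of_isMinOn hM (m.hasGradientAt_P₁ k _) (hx.x_argmin t)

theorem F_add_stepEnergy_le (hx : IsPreDCAe m k M β x y ξ) (hM : M.IsSymmetric)
    (hAM : ∀ u, ‖m.A u‖ ^ 2 ≤ sqNormM M u) (t : ℕ) :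
    m.F k (x (t + 1)) + stepEnergy M x (t + 1) ≤
      m.F k (x t) + (⨆ t, β t) * stepEnergy M x t := by
  have hf_upper : m.f (x (t + 1)) ≤ m.f (y t) + ⟪gradient m.f (y t), x (t + 1) - y t⟫ +
      sqNormM M (x (t + 1) - y t) / 2 := by
    linarith [m.f_eq_add (y t) (x (t + 1)), hAM (x (t + 1) - y t)]
  have h_step := add_sqNormM_le_of_step hM hf_upper (m.gradient_f_mem_convexSubdiff (y t))
    (m.hessP₁_mem_convexSubdiff k _) (hx.ξ_mem t) (hx.optimality hM t)
  rw [hx.sub_extrapolation_eq, sqNormM_smul, neg_sq, mul_div_assoc, ← m.P_eq_sub,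
    ← m.P_eq_sub] at h_step
  have h_energy : 0 ≤ stepEnergy M x t := div_nonneg ((sq_nonneg _).trans (hAM _)) zero_le_two
  have h_extrapolation := mul_le_mul_of_nonneg_right (hx.sq_beta_le_iSup t) h_energy
  exact h_step.trans (add_le_add_right h_extrapolation _)

theorem exists_sq_norm_residual_le (hx : IsPreDCAe m k M β x y ξ) {L : ℝ≥0}
    (hL : LipschitzWith L (gradient m.f)) (hM : M.IsSymmetric) {κ : ℝ} (hκ : 0 < κ)
    (hκM : ∀ u, κ * ‖u‖ ^ 2 ≤ sqNormM M u) :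
    ∃ C : ℝ, 0 ≤ C ∧ ∀ t, ‖gradient m.f (x t) + m.hessP₁ (x t) - ξ t‖ ^ 2 ≤
      C * (stepEnergy M x t + stepEnergy M x (t + 1)) := by
  set N := LinearMap.toContinuousLinearMap M
  set Q := LinearMap.toContinuousLinearMap m.hessP₁
  set C := L + ‖Q‖₊ + ‖N‖
  have h_norm_le_energy : ∀ t, ‖x t - x (t - 1)‖ ^ 2 ≤ 2 / κ * stepEnergy M x t := fun t => by
    rw [div_mul_eq_mul_div, le_div_iff₀ hκ, stepEnergy]
    linarith [hκM (x t - x (t - 1))]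
  refine ⟨4 * C ^ 2 / κ, by positivity, fun t => ?_⟩
  have h_res : ‖gradient m.f (x t) + m.hessP₁ (x t) - ξ t‖ ≤
      C * (‖x (t + 1) - x t‖ + ‖x t - x (t - 1)‖) :=
    (norm_residual_le hL Q.lipschitz N (hx.optimality hM t)).trans
      (by gcongr; exact hx.norm_sub_extrapolation_le t)
  have h_next := h_norm_le_energy (t + 1)
  rw [add_tsub_cancel_right] at h_next
  calc ‖gradient m.f (x t) + m.hessP₁ (x t) - ξ t‖ ^ 2
      ≤ (C * (‖x (t + 1) - x t‖ + ‖x t - x (t - 1)‖)) ^ 2 := by gcongr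
    _ ≤ C ^ 2 * (2 * (‖x (t + 1) - x t‖ ^ 2 + ‖x t - x (t - 1)‖ ^ 2)) := by
        rw [mul_pow]
        gcongr
        exact add_sq_le
    _ ≤ C ^ 2 * (2 * (2 / κ * stepEnergy M x (t + 1) + 2 / κ * stepEnergy M x t)) := by
        gcongr
        exact h_norm_le_energy t
    _ = 4 * C ^ 2 / κ * (stepEnergy M x t + stepEnergy M x (t + 1)) := by ring

theorem exists_eventually_growth (hx : IsPreDCAe m k M β x y ξ) {L : ℝ≥0}
    (hL : LipschitzWith L (gradient m.f)) (hM : M.IsSymmetric) {κ : ℝ} (hκ : 0 < κ)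
    (hκA : ∀ u, κ * ‖u‖ ^ 2 ≤ ‖m.A u‖ ^ 2) (hAM : ∀ u, ‖m.A u‖ ^ 2 ≤ sqNormM M u)
    {a : EuclideanSpace ℝ Ω} (hlim : Tendsto x atTop (𝓝 a)) :
    ∃ C : ℝ, 0 ≤ C ∧ ∀ᶠ t in atTop, m.F k (x t) - m.F k a + κ / 4 * ‖x t - a‖ ^ 2 ≤
      C * (stepEnergy M x t + stepEnergy M x (t + 1)) := by
  obtain ⟨C, hC, h_res⟩ := hx.exists_sq_norm_residual_le hL hM hκ fun u => (hκA u).trans (hAM u)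
  refine ⟨C / κ, by positivity, ?_⟩
  filter_upwards [hlim.eventually (m.eventually_F_sub_le_inner k a)] with t ht
  have h_inner : m.F k (x t) - m.F k a + κ / 2 * ‖x t - a‖ ^ 2 ≤
      ⟪gradient m.f (x t) + m.hessP₁ (x t) - ξ t, x t - a⟫ := by
    linarith [ht (ξ t) (hx.ξ_mem t), hκA (x t - a)]
  calc m.F k (x t) - m.F k a + κ / 4 * ‖x t - a‖ ^ 2
      ≤ ‖gradient m.f (x t) + m.hessP₁ (x t) - ξ t‖ ^ 2 / κ :=
        add_mul_sq_norm_le_of_le_inner hκ h_inner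
    _ ≤ C * (stepEnergy M x t + stepEnergy M x (t + 1)) / κ := by gcongr; exact h_res t
    _ = C / κ * (stepEnergy M x t + stepEnergy M x (t + 1)) := by ring

end IsPreDCAe

theorem mainTheorem2_general {Ω Y : Type*} [Fintype Ω] [NormedAddCommGroup Y]
    [InnerProductSpace ℝ Y] (m : TQModel Ω Y) (k : TQKind) (hF : LevelBounded (m.F k))
    (L : ℝ≥0) (hL : LipschitzWith L (gradient m.f))
    (M : EuclideanSpace ℝ Ω →ₗ[ℝ] EuclideanSpace ℝ Ω) (hM : M.IsSymmetric)
    (hML : ∀ u, (L : ℝ) * ‖u‖ ^ 2 ≤ sqNormM M u)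
    (β : ℕ → ℝ) (x y ξ : ℕ → EuclideanSpace ℝ Ω) (hx : IsPreDCAe m k M β x y ξ)
    (xbar : EuclideanSpace ℝ Ω) (hlim : Tendsto x atTop (𝓝 xbar)) :
    ∃ c₁ : ℝ, 0 < c₁ ∧ ∃ t₀ : ℕ, 0 < t₀ ∧ ∃ η ∈ Set.Ioo (0 : ℝ) 1,
      ∀ t, t₀ < t → ‖x t - xbar‖ < c₁ * η ^ t := by
  have hAM : ∀ u, ‖m.A u‖ ^ 2 ≤ sqNormM M u := fun u => (m.sq_norm_A_le hL u).trans (hML u)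
  obtain ⟨κ, hκ, hκA⟩ := exists_pos_mul_sq_norm_le (m.ker_A_eq_bot_of_levelBounded hF)
  obtain ⟨C, hC, h_growth⟩ := hx.exists_eventually_growth hL hM hκ hκA hAM hlim
  have h_energy : ∀ t, 0 ≤ stepEnergy M x t := fun t =>
    div_nonneg ((sq_nonneg _).trans (hAM _)) zero_le_two
  have h_descent : ∀ t, m.F k (x (t + 1)) - m.F k xbar + stepEnergy M x (t + 1) ≤
      m.F k (x t) - m.F k xbar + (⨆ t, β t) * stepEnergy M x t := fun t => by
    linarith [hx.F_add_stepEnergy_le hM hAM t]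
  have h_gap : Tendsto (fun t => m.F k (x t) - m.F k xbar) atTop (𝓝 0) := by
    simpa using (((m.continuous_F k).tendsto xbar).comp hlim).sub_const (m.F k xbar)
  exact exists_lt_mul_pow_of_descent_of_growth hx.β_sup (by positivity) hC h_energy h_descent
    h_growth h_gap (tendsto_stepEnergy_zero hM.continuous hlim)

theorem mainTheorem2 {Ω Y : Type*} [Fintype Ω] [NormedAddCommGroup Y] [InnerProductSpace ℝ Y]
    (m : TQModel Ω Y) (k : TQKind) (hF : LevelBounded (m.F k))
    (L : ℝ≥0) (hL : LipschitzWith L (gradient m.f))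
    (M : EuclideanSpace ℝ Ω →ₗ[ℝ] EuclideanSpace ℝ Ω) (hM : IsMetricOp M)
    (hML : ∀ u, (L : ℝ) * ‖u‖ ^ 2 ≤ sqNormM M u)
    (β : ℕ → ℝ) (x y ξ : ℕ → EuclideanSpace ℝ Ω) (hx : IsPreDCAe m k M β x y ξ)
    (xbar : EuclideanSpace ℝ Ω) (hlim : Tendsto x atTop (𝓝 xbar))
    (hE : IsKLFunctionWithExponent (m.E k M) (1 / 2)) :
    ∃ c₁ : ℝ, 0 < c₁ ∧ ∃ t₀ : ℕ, 0 < t₀ ∧ ∃ η ∈ Set.Ioo (0 : ℝ) 1,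
      ∀ t, t₀ < t → ‖x t - xbar‖ < c₁ * η ^ t :=
  mainTheorem2_general m k hF L hL M hM.symm hML β x y ξ hx xbar hlim
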